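/- Let $G$ be (the topological realization of) a finite connected directed graph, in which multiple edges are allowed but looped edges are not, and suppose that the free group $\pi=\pi_1(G)$ has at least two generators (that is, $\pi$ is not cyclic). Let $p:\widetilde G\to G$ be the universal covering space, and identify the elements of $\pi$ with the covering transformations of $\widetilde G$. Let $f:G\to G$ be a continuous map that is homotopic to the identity and such that the vertices of $G$ form one periodic orbit of $f$. Let $\widetilde f:\widetilde G\to\widetilde G$ be the lift of $f$ that commutes with all covering transformations. If $n\ge 1$ and $f^n(x)=x$, choose $\widetilde x\in p^{-1}(x)$; then $\widetilde f^{\,n}(\widetilde x)=w\widetilde x$ for a unique $w\in\pi$, and the rotation element of $x$ is $\rho(x)=w^{1/n}$. Exponents are formal, subject to $(w^k)^{r}=w^{kr}$; the rotation element is defined up to conjugacy (another choice of $\widetilde x$, or of a point in the orbit of $x$, replaces $w$ by a conjugate), so $w^{1/m}$ and $u^{1/n}$ are the same rotation element if and only if $w^n$ and $u^m$ are conjugate in $\pi$. An edge $E$ belongs to $w\in\pi$ if every cyclic reduction of $w$ (every edge loop that is freely homotopic to $w$ and in which no directed edge is followed, cyclically, by its reverse) uses $E$ or $E^{-1}$.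 Let $w^{1/v}$ be the rotation element of one of the vertices. If every edge of $G$ belongs to $w$, then $f$ has infinitely many periodic orbits with different rotation elements: there are periodic points $z_0,z_1,z_2,\dots$ of $f$ that lie in pairwise distinct orbits and whose rotation elements are pairwise different, even up to conjugacy. -/

import Mathlib

open scoped unitInterval

/-- A directed multigraph with vertex set `V` and edge set `E`. Several edges between two vertices
are allowed, looped edges are not. -/
structure Multigraph (V E : Type*) where
  src : E → V
  tgt : E → V
  src_ne_tgt : ∀ e, src e ≠ tgt e

namespace Multigraph

variable {V E : Type*} (Γ : Multigraph V E)

/-- The gluing relation: the edge `{e} × [0,1]` is attached to its initial vertex at `0` and to its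
terminal vertex at `1`. -/
inductive Glue : V ⊕ E × I → V ⊕ E × I → Prop
  | src (e : E) : Glue (Sum.inr (e, 0)) (Sum.inl (Γ.src e))
  | tgt (e : E) : Glue (Sum.inr (e, 1)) (Sum.inl (Γ.tgt e))

/-- The graph as a topological space: the vertices together with one copy of the unit interval for
each edge, glued along the endpoints of the edges. -/
def Realization : Type _ := Quot Γ.Glue

/-- The point of the space that is the vertex `v`. -/
def vertex (v : V) : Γ.Realization := Quot.mk _ (Sum.inl v)

/-- The parametrization of the edge `e` by the unit interval. -/
def edge (e : E) (t : I) : Γ.Realization := Quot.mk _ (Sum.inr (e, t))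

/-- The quotient topology (for discrete `V` and `E`): a set is open if and only if its preimage
under the parametrization of every edge is open. -/
instance : TopologicalSpace Γ.Realization :=
  ⨆ e : E, TopologicalSpace.coinduced (Γ.edge e) inferInstance

/-- An edge that is traversed in a direction: `(e, true)` stands for `e` and `(e, false)` for the
reverse of `e`. This is its parametrization. -/
def dart (d : E × Bool) (t : I) : Γ.Realization :=
  if d.2 then Γ.edge d.1 t else Γ.edge d.1 (σ t)

/-- The vertices of the graph form one periodic orbit of `f`. -/
def VerticesFormOnePeriodicOrbit (f : Γ.Realization → Γ.Realization) : Prop :=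
  ∃ x ∈ Function.periodicPts f, Set.range Γ.vertex = Set.range (fun k : ℕ => f^[k] x)

end Multigraph

/-- The group of covering transformations of `p`. -/
def deckGroup {X Y : Type*} [TopologicalSpace X] (p : X → Y) : Subgroup (X ≃ₜ X) where
  carrier := {φ | ∀ x, p (φ x) = p x}
  mul_mem' := by
    intro a b ha hb x
    exact (ha (b x)).trans (hb x)
  one_mem' := fun _ => rfl
  inv_mem' := by
    intro a ha x
    have h := ha (a.symm x)
    rw [a.apply_symm_apply] at h
    exact h.symm

/-- `F` is a lift of `f` through `p` that commutes with all covering transformations. -/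
structure IsEquivariantLift {X Y : Type*} [TopologicalSpace X] (p : X → Y) (f : Y → Y)
    (F : X → X) : Prop where
  lift : ∀ x, p (F x) = f (p x)
  comm : ∀ γ ∈ deckGroup p, ∀ x, F (γ x) = γ (F x)

/-- The rotation element of the point `y`, with respect to the lift `F` of a self-map of the base,
is `w ^ (1 / n)`: `n` is a positive integer and `F ^ n` maps some lifted copy `x` of `y` to `w x`.
(Other lifted copies of `y` replace `w` by its conjugates.) -/
def HasRotationElement {X Y : Type*} [TopologicalSpace X] (p : X → Y) (F : X → X) (y : Y)
    (w : deckGroup p) (n : ℕ) : Prop :=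
  0 < n ∧ ∃ x, p x = y ∧ F^[n] x = (w : X ≃ₜ X) x

/-- The rotation elements `w ^ (1 / m)` and `u ^ (1 / n)` are the same up to conjugacy. Here
`w ^ (1 / m) = (w ^ n) ^ (1 / (m * n))` and `u ^ (1 / n) = (u ^ m) ^ (1 / (m * n))`. -/
def SameRotation {π : Type*} [Group π] (w : π) (m : ℕ) (u : π) (n : ℕ) : Prop :=
  IsConj (w ^ n) (u ^ m)

namespace Multigraph

variable {V E X : Type*} [TopologicalSpace X] (Γ : Multigraph V E)

/-- `Γ.EdgePathLifts p a l b`: the list `l` of directed edges is an edge path in the graph which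
has a lift through `p` that starts at `a` and ends at `b`. -/
inductive EdgePathLifts (p : X → Γ.Realization) : X → List (E × Bool) → X → Prop
  | nil (a : X) : EdgePathLifts p a [] a
  | cons {a b c : X} {d : E × Bool} {l : List (E × Bool)} (γ : Path a b)
      (hγ : ∀ t, p (γ t) = Γ.dart d t) (hl : EdgePathLifts p b l c) :
      EdgePathLifts p a (d :: l) c

/-- The edge loop `l` is a cyclic reduction of the element `w` of the fundamental group (seen as a
covering transformation of the universal cover `p`): no directed edge in `l` is followed,
cyclically, by its reverse, and `l` is freely homotopic to `w`, that is, some lift of `l` leads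
from a point `a` to the point `w a`. -/
def IsCyclicReduction (p : X → Γ.Realization) (w : deckGroup p) (l : List (E × Bool)) : Prop :=
  Cycle.Chain (fun d d' => d' ≠ (d.1, !d.2)) (l : Cycle (E × Bool)) ∧
    ∃ a : X, Γ.EdgePathLifts p a l ((w : X ≃ₜ X) a)

/-- The edge `e` belongs to `w`: every cyclic reduction of `w` uses `e` or its reverse. -/
def Belongs (p : X → Γ.Realization) (e : E) (w : deckGroup p) : Prop :=
  ∀ l, Γ.IsCyclicReduction p w l → ∃ b : Bool, (e, b) ∈ l

end Multigraph

/-!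
Since the universal cover `X` is simply connected, it is a tree: collapsing the complement of an
open lifted edge gives a map from `X` to the circle, and its lift `Multigraph.LiftedDart.height` to
the real line shows that the open edge cuts `X` into two half-trees. All combinatorial arguments use
only these half-trees and are carried out for an abstract `CutTree`; the tree `X` is the instance
`Multigraph.LiftedDart.tree`.

As the vertices form one orbit, `F ^ v` moves every vertex `a` of the tree by a conjugate `W a` of
`w`, with `W (u • a) = u * W a * u⁻¹`. If `W` were constant, then `w` would be central. But all
elements that commute with `w` translate along its axis, so the fundamental group would be cyclic
(`CutTree.IsAxis.isCyclic_of_central`). Hence some edge `d`, with endpoints `a` and `b`, has `W a ≠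
W b`. These elements have the same translation length, so their axes have no common end
(`CutTree.IsAxis.exists_shift`, `CutTree.IsAxis.eq_of_shift`). All edges far along the axis of `W a`
therefore separate `W a ^ k • a` from `W b ^ k • b` for all large `k`. Every edge of the graph
belongs to `w`, so that `d`, up to direction, has translates far along this axis, and one of them is
a proper translate `u • d` with `u ≠ 1` (`CutTree.exists_separating_smul`).

Now `u • d` separates the images of the endpoints of `d` under `F ^ (v * k)`. A one-dimensional
fixed point argument (`Multigraph.LiftedDart.exists_apply_eq_smul`) gives a point `y` of `d` with `F
^ (v * k) y = u • y`, that is, a periodic point with rotation element `u ^ (1 / (v * k))`. The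
element `u` does not depend on `k`. In a group acting freely on a tree, conjugate positive powers of
`u ≠ 1` have equal exponents because translation lengths are conjugation invariant
(`CutTree.IsAxis.eq_of_isConj_pow`), so these rotation elements are different for different `k`.
Points of one orbit have the same rotation element, so the orbits are different too.
-/

/-! ### Trees presented by half-trees -/

/-- A tree, presented by its darts (directed edges) and its half-trees: `side d` is the set of
vertices beyond the dart `d`. An edge path leaves or enters this set only along `d` or its
reverse, so every edge is a bridge; together with connectedness this says that the graph is a
tree. -/
structure CutTree (A D : Type*) where
  src : D → A
  tgt : D → A
  rev : D → D
  rev_rev : ∀ d, rev (rev d) = d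
  src_rev : ∀ d, src (rev d) = tgt d
  tgt_rev : ∀ d, tgt (rev d) = src d
  side : D → A → Prop
  not_side_src : ∀ d, ¬ side d (src d)
  side_tgt : ∀ d, side d (tgt d)
  side_iff : ∀ d d', d' ≠ d → d' ≠ rev d → (side d (src d') ↔ side d (tgt d'))
  connected : ∀ a b, Relation.ReflTransGen (fun x y => ∃ d, src d = x ∧ tgt d = y) a b

namespace CutTree

open Filter

variable {A D π : Type*} (T : CutTree A D)

/-- A bi-infinite edge path `c` without backtracking. -/
structure IsLine (c : ℤ → D) : Prop where
  adj : ∀ i, T.tgt (c i) = T.src (c (i + 1))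
  reduced : ∀ i, c (i + 1) ≠ T.rev (c i)

/-- A group acts on the tree, freely on the vertices and without inverting edges. -/
structure IsFreeAction (T : CutTree A D) (π : Type*) [Group π] [MulAction π A] [MulAction π D] :
    Prop where
  src_smul : ∀ (g : π) d, T.src (g • d) = g • T.src d
  tgt_smul : ∀ (g : π) d, T.tgt (g • d) = g • T.tgt d
  rev_smul : ∀ (g : π) d, T.rev (g • d) = g • T.rev d
  side_smul : ∀ (g : π) d a, T.side (g • d) (g • a) ↔ T.side d a
  eq_one_of_smul_eq : ∀ (g : π) (a : A), g • a = a → g = 1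
  smul_ne_rev : ∀ (g : π) d, g • d ≠ T.rev d

/-- The line `c` is an axis of `g`, along which `g` translates by `m` darts. -/
structure IsAxis [SMul π D] (g : π) (c : ℤ → D) (m : ℤ) : Prop extends T.IsLine c where
  pos : 0 < m
  smul : ∀ i, g • c i = c (i + m)

variable {T}

theorem ne_of_adj {c c' : D} (h : T.tgt c = T.src c') : c' ≠ c := by
  rintro rfl
  exact T.not_side_src c' (h ▸ T.side_tgt c')

/-- Half-trees are nested along an edge path without backtracking: a path that starts beyond `c'`
and not beyond `c` could leave this region neither along `c` nor along `c'`. -/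
theorem side_of_side_of_adj {c c' : D} (h : T.tgt c = T.src c') (hne : c' ≠ T.rev c) {x : A}
    (hx : T.side c' x) : T.side c x := by
  by_contra hx'
  have hcc : c' ≠ c := ne_of_adj h
  have hne' : c ≠ T.rev c' := fun e => hne (by rw [e, T.rev_rev])
  have key : ∀ y, Relation.ReflTransGen (fun x y => ∃ d, T.src d = x ∧ T.tgt d = y) x y →
      T.side c' y ∧ ¬ T.side c y := by
    intro y hy
    induction hy with
    | refl => exact ⟨hx, hx'⟩
    | tail _ hd ih =>
      obtain ⟨d, rfl, rfl⟩ := hd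
      obtain ⟨h1, h2⟩ := ih
      have hdc : d ≠ c := by
        rintro rfl
        rw [T.side_iff c' d hcc.symm hne', h] at h1
        exact T.not_side_src _ h1
      have hdc' : d ≠ T.rev c := by
        rintro rfl
        rw [T.src_rev] at h2
        exact h2 (T.side_tgt c)
      have hd1 : d ≠ c' := by
        rintro rfl
        exact T.not_side_src _ h1
      have hd2 : d ≠ T.rev c' := by
        rintro rfl
        rw [T.src_rev, ← T.side_iff c c' hcc hne, ← h] at h2
        exact h2 (T.side_tgt c)
      exact ⟨(T.side_iff c' d hd1 hd2).1 h1, fun h3 => h2 ((T.side_iff c d hdc hdc').2 h3)⟩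
  exact (key _ (T.connected x (T.tgt c))).2 (T.side_tgt c)

namespace IsLine

variable {c c' : ℤ → D}

theorem side_mono (hc : T.IsLine c) {i j : ℤ} (hij : i ≤ j) {x : A} (hx : T.side (c j) x) :
    T.side (c i) x := by
  induction j, hij using Int.leInduction with
  | base => exact hx
  | succ j _ ih => exact ih (side_of_side_of_adj (hc.adj j) (hc.reduced j) hx)

theorem side_src_iff (hc : T.IsLine c) {i j : ℤ} : T.side (c i) (T.src (c j)) ↔ i < j := by
  refine ⟨fun h => ?_, fun h => ?_⟩
  · by_contra hij
    exact T.not_side_src _ (hc.side_mono (not_lt.1 hij) h) |>.elim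
  · have : T.side (c (j - 1)) (T.src (c j)) := by
      have := hc.adj (j - 1)
      rw [sub_add_cancel] at this
      rw [← this]
      exact T.side_tgt _
    exact hc.side_mono (by omega) this

theorem src_injective (hc : T.IsLine c) : Function.Injective fun i => T.src (c i) := by
  intro i j hij
  by_contra hne
  rcases lt_or_gt_of_ne hne with h | h
  · exact T.not_side_src (c i) (by rw [show T.src (c i) = T.src (c j) from hij]
                                   exact hc.side_src_iff.2 h)
  · exact T.not_side_src (c j) (by rw [← show T.src (c i) = T.src (c j) from hij]
                                   exact hc.side_src_iff.2 h)

theorem injective (hc : T.IsLine c) : Function.Injective c := fun _ _ h =>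
  hc.src_injective (congrArg T.src h)

end IsLine

/-- A path between two vertices is finite, so only finitely many edges separate them. -/
theorem eventually_side_iff {ι : Type*} {g : ι → D} (hg : Function.Injective g) (x y : A) :
    ∀ᶠ i in cofinite, (T.side (g i) x ↔ T.side (g i) y) := by
  have h := T.connected x y
  induction h with
  | refl => exact .of_forall fun _ => Iff.rfl
  | tail _ hd ih =>
    obtain ⟨d, rfl, rfl⟩ := hd
    have key : ∀ e, ∀ᶠ i in cofinite, g i ≠ e := fun e =>
      hg.tendsto_cofinite.eventually (eventually_cofinite_ne e)
    filter_upwards [ih, key d, key (T.rev d)] with i h1 h2 h3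
    rw [h1]
    exact T.side_iff _ _ (Ne.symm h2) (fun e => h3 (by rw [e, T.rev_rev]))

namespace IsLine

variable {c : ℤ → D}

theorem eventually_not_side (hc : T.IsLine c) (x : A) : ∀ᶠ i in atTop, ¬ T.side (c i) x := by
  filter_upwards [(eventually_side_iff hc.injective x (T.src (c 0))).filter_mono atTop_le_cofinite,
    eventually_ge_atTop 0] with i h hi
  rw [h, hc.side_src_iff]
  omega

theorem eventually_side (hc : T.IsLine c) (x : A) : ∀ᶠ i in atBot, T.side (c i) x := by
  filter_upwards [(eventually_side_iff hc.injective x (T.src (c 0))).filter_mono atBot_le_cofinite,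
    eventually_lt_atBot 0] with i h hi
  rwa [h, hc.side_src_iff]

end IsLine

variable [Group π] [MulAction π A] [MulAction π D]

section

variable (hT : T.IsFreeAction π)
include hT

theorem IsFreeAction.smul_right_injective (d : D) : Function.Injective fun g : π => g • d := by
  intro g h hgh
  have h1 : (h⁻¹ * g) • T.src d = T.src d := by
    rw [mul_smul, ← hT.src_smul, show g • d = h • d from hgh, hT.src_smul, inv_smul_smul]
  exact (inv_mul_eq_one.1 (hT.eq_one_of_smul_eq _ _ h1)).symm

theorem IsFreeAction.side_smul_iff (g : π) (d : D) (a : A) :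
    T.side d (g • a) ↔ T.side (g⁻¹ • d) a := by
  rw [← hT.side_smul g (g⁻¹ • d), smul_inv_smul]

theorem IsLine.smul {c : ℤ → D} (hc : T.IsLine c) (g : π) : T.IsLine fun i => g • c i where
  adj i := by rw [hT.tgt_smul, hT.src_smul, hc.adj]
  reduced i h := hc.reduced i (by rw [hT.rev_smul] at h; exact smul_left_cancel g h)

end

namespace IsAxis

variable {g h : π} {c c' : ℤ → D} {m m' : ℤ}

omit [MulAction π A] in
theorem ne_one (hc : T.IsAxis g c m) : g ≠ 1 := by
  rintro rfl
  have h1 := hc.smul 0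
  rw [one_smul] at h1
  have := hc.injective h1
  have := hc.pos
  omega

omit [MulAction π A] in
theorem pow_smul (hc : T.IsAxis g c m) (k : ℕ) (i : ℤ) : g ^ k • c i = c (i + k * m) := by
  induction k with
  | zero => simp
  | succ k ih =>
    rw [pow_succ', mul_smul, ih, hc.smul]
    congr 1
    push_cast
    ring

omit [MulAction π A] in
theorem pow (hc : T.IsAxis g c m) {k : ℕ} (hk : 0 < k) : T.IsAxis (g ^ k) c (k * m) where
  toIsLine := hc.toIsLine
  pos := mul_pos (by exact_mod_cast hk) hc.pos
  smul i := hc.pow_smul k i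

omit [MulAction π A] in
theorem pow_injective (hc : T.IsAxis g c m) : Function.Injective fun k : ℕ => g ^ k := by
  intro k l hkl
  have h1 := hc.pow_smul k 0
  rw [show g ^ k = g ^ l from hkl, hc.pow_smul l 0] at h1
  have h2 := hc.injective h1
  have := mul_right_cancel₀ hc.pos.ne' (add_left_cancel h2)
  exact_mod_cast this.symm

variable (hT : T.IsFreeAction π)
include hT

theorem conj (hc : T.IsAxis g c m) (u : π) : T.IsAxis (u * g * u⁻¹) (fun i => u • c i) m where
  toIsLine := hc.toIsLine.smul hT u
  pos := hc.pos
  smul i := by rw [mul_smul, mul_smul, inv_smul_smul, hc.smul]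

theorem eventually_side_pow_smul (hc : T.IsAxis g c m) (i : ℤ) (x : A) :
    ∀ᶠ k : ℕ in atTop, T.side (c i) (g ^ k • x) := by
  have hlim : Tendsto (fun k : ℕ => i - k * m) atTop atBot := by
    refine tendsto_atBot.2 fun b => ?_
    filter_upwards [eventually_ge_atTop (i - b).toNat] with k hk
    have h1 : i - b ≤ k := Int.toNat_le.1 hk
    have h2 : (k : ℤ) ≤ k * m := le_mul_of_one_le_right (Int.natCast_nonneg k) hc.pos
    omega
  filter_upwards [hlim.eventually (hc.eventually_side x)] with k hk
  have := hc.pow_smul k (i - k * m)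
  rw [sub_add_cancel] at this
  rwa [← this, hT.side_smul]

/-- The powers of `g` eventually drive any two vertices to the same side of a given dart. -/
theorem eventually_side_pow_smul_iff (hc : T.IsAxis g c m) (d : D) (x y : A) :
    ∀ᶠ k : ℕ in atTop, (T.side d (g ^ k • x) ↔ T.side d (g ^ k • y)) := by
  have hinj : Function.Injective fun k : ℕ => (g ^ k)⁻¹ • d := fun k l hkl =>
    hc.pow_injective (inv_injective (hT.smul_right_injective d hkl))
  rw [← Nat.cofinite_eq_atTop]
  filter_upwards [eventually_side_iff hinj x y] with k hk
  rwa [hT.side_smul_iff, hT.side_smul_iff]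

/-- If the orbit of some vertex under the powers of `h` keeps returning beyond every dart of the
line `c`, then `c` and the axis of `h` have a common end. -/
theorem exists_shift (hc : T.IsLine c) (hc' : T.IsAxis h c' m') {b : A}
    (hb : ∀ i, ∃ᶠ k : ℕ in atTop, T.side (c i) (h ^ k • b)) :
    ∃ t : ℤ, ∀ᶠ i in atTop, c i = c' (i + t) := by
  obtain ⟨i₀, hi₀⟩ := eventually_atTop.1 (hc.eventually_not_side (T.src (c' 0)))
  -- The axis of `h` starts outside the half-tree of `c i` and enters it later on.
  have hmem : ∀ i, i₀ ≤ i → ∃ j, c' j = c i := by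
    intro i hi
    obtain ⟨k, hk, hk'⟩ :=
      ((hb i).and_eventually (eventually_side_pow_smul_iff hT hc' (c i) b (T.src (c' 0)))).exists
    rw [hk', ← hT.src_smul, hc'.pow_smul, zero_add] at hk
    have hcross : ∃ j : ℕ, ¬ T.side (c i) (T.src (c' j)) ∧ T.side (c i) (T.src (c' (j + 1))) := by
      by_contra! hno
      have hall : ∀ j : ℕ, ¬ T.side (c i) (T.src (c' j)) := by
        intro j
        induction j with
        | zero => exact hi₀ i hi
        | succ j ih => exact_mod_cast hno j ih
      obtain ⟨n, hn⟩ := Int.eq_ofNat_of_zero_le (mul_nonneg (Int.natCast_nonneg k) hc'.pos.le)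
      exact hall n (by rw [← hn]; exact hk)
    obtain ⟨j, hj, hj'⟩ := hcross
    rw [← hc'.adj] at hj'
    refine ⟨j, ?_⟩
    by_contra hne
    by_cases hrev : c' j = T.rev (c i)
    · rw [hrev, T.src_rev] at hj
      exact hj (T.side_tgt _)
    · exact hj ((T.side_iff _ _ hne hrev).2 hj')
  obtain ⟨j₀, hj₀⟩ := hmem i₀ le_rfl
  refine ⟨j₀ - i₀, eventually_atTop.2 ⟨i₀, fun i hi => ?_⟩⟩
  induction i, hi using Int.leInduction with
  | base => rw [← hj₀]; congr 1; ring
  | succ i hi ih =>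
    obtain ⟨j, hj⟩ := hmem (i + 1) (by omega)
    have h1 : T.src (c' j) = T.src (c' (i + (j₀ - i₀) + 1)) := by
      rw [hj, ← hc'.adj, ← ih, hc.adj]
    have h2 : j = i + (j₀ - i₀) + 1 := hc'.src_injective h1
    rw [← hj, h2]
    congr 1
    ring

/-- Two axes of the same element have a common end. -/
theorem exists_shift_of_isAxis (hc : T.IsAxis g c m) (hc' : T.IsAxis g c' m') :
    ∃ t : ℤ, ∀ᶠ i in atTop, c i = c' (i + t) :=
  exists_shift hT hc.toIsLine hc' (b := T.src (c 0)) fun i =>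
    (hc.eventually_side_pow_smul hT i _).frequently

theorem eq_of_shift (hc : T.IsAxis g c m) (hc' : T.IsAxis h c' m) {t : ℤ}
    (ht : ∀ᶠ i in atTop, c i = c' (i + t)) : g = h := by
  obtain ⟨i, h1, h2⟩ :=
    (ht.and (tendsto_atTop_add_const_right _ m tendsto_id |>.eventually ht)).exists
  refine hT.smul_right_injective (c i) ?_
  simp only [id] at h2 ⊢
  rw [hc.smul, h2]
  rw [h1, hc'.smul]
  congr 1
  ring

/-- The translation length of an element is well defined. -/
theorem length_unique (hc : T.IsAxis g c m) (hc' : T.IsAxis g c' m') : m = m' := by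
  obtain ⟨t, ht⟩ := exists_shift_of_isAxis hT hc hc'
  obtain ⟨i, h1, h2⟩ :=
    (ht.and (tendsto_atTop_add_const_right _ m tendsto_id |>.eventually ht)).exists
  simp only [id] at h2
  rw [← hc.smul, h1, hc'.smul] at h2
  have := hc'.injective h2
  omega

/-- Conjugate positive powers of a nontrivial element have equal exponents: the translation length
is conjugation invariant and multiplicative on powers. -/
theorem eq_of_isConj_pow (hc : T.IsAxis g c m) {r s : ℕ} (hr : 0 < r) (hs : 0 < s)
    (hconj : IsConj (g ^ r) (g ^ s)) : r = s := by
  obtain ⟨u, hu⟩ := isConj_iff.1 hconj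
  have h1 := (hc.pow hr).conj hT u
  rw [hu] at h1
  have h2 := length_unique hT h1 (hc.pow hs)
  exact_mod_cast mul_right_cancel₀ hc.pos.ne' h2

/-- If some hyperbolic element is central, then all elements translate along its axis. -/
theorem isCyclic_of_central (hc : T.IsAxis g c m) (hg : ∀ u : π, u * g * u⁻¹ = g) :
    IsCyclic π := by
  have hex : ∀ u : π, ∃ t : ℤ, ∀ᶠ i in atTop, u • c i = c (i + t) := fun u => by
    have h1 := hc.conj hT u
    rw [hg] at h1
    exact exists_shift_of_isAxis hT h1 hc
  choose t ht using hex
  have huniq : ∀ u s, (∀ᶠ i in atTop, u • c i = c (i + s)) → t u = s := by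
    intro u s hs
    obtain ⟨i, h1, h2⟩ := ((ht u).and hs).exists
    exact add_left_cancel (hc.injective (h1.symm.trans h2))
  let φ : π →* Multiplicative ℤ := MonoidHom.mk' (fun u => Multiplicative.ofAdd (t u)) (by
    intro u v
    rw [← ofAdd_add]
    congr 1
    apply huniq
    filter_upwards [ht v, tendsto_atTop_add_const_right _ (t v) tendsto_id |>.eventually (ht u)]
      with i h1 h2
    simp only [id] at h2
    rw [mul_smul, h1, h2]
    congr 1
    ring)
  refine isCyclic_of_injective φ ((injective_iff_map_eq_one φ).2 fun u hu => ?_)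
  have hu' : t u = 0 := hu
  obtain ⟨i, hi⟩ := (ht u).exists
  refine hT.smul_right_injective (c i) ?_
  simp only [one_smul]
  rw [hi, hu', add_zero]

end IsAxis

/-! ### Existence of axes, and separating translates -/

/-- An edge path from a vertex to its image under `g` extends to a bi-infinite `g`-periodic one. -/
theorem exists_periodic_extension (hT : T.IsFreeAction π) {g : π} {n : ℕ} (hn : 0 < n) {δ : ℕ → D}
    (hadj : ∀ r, r + 1 < n → T.tgt (δ r) = T.src (δ (r + 1)))
    (hlast : T.tgt (δ (n - 1)) = g • T.src (δ 0)) :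
    ∃ c : ℤ → D, (∀ i, T.tgt (c i) = T.src (c (i + 1))) ∧ ∀ i, g • c i = c (i + n) := by
  have hn' : (n : ℤ) ≠ 0 := by omega
  refine ⟨fun z => g ^ (z / n) • δ (z % n).toNat, fun i => ?_, fun i => ?_⟩
  · have h0 := Int.emod_nonneg i hn'
    have h1 := Int.emod_lt_of_pos i (show (0 : ℤ) < n by omega)
    have h2 := Int.mul_ediv_add_emod i n
    simp only [hT.tgt_smul, hT.src_smul]
    by_cases h : i % n + 1 < n
    · have hd : (i + 1) / n = i / n ∧ (i + 1) % n = i % n + 1 :=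
        (Int.ediv_emod_unique (by omega)).2 ⟨by linarith, by omega, h⟩
      rw [hd.1, hd.2, Int.toNat_add h0 (by omega)]
      congr 1
      exact hadj _ (by omega)
    · have hd : (i + 1) / n = i / n + 1 ∧ (i + 1) % n = 0 :=
        (Int.ediv_emod_unique (by omega)).2 ⟨by rw [mul_add]; omega, le_rfl, by omega⟩
      rw [hd.1, hd.2, show (i % n).toNat = n - 1 by omega, hlast, zpow_add_one, mul_smul]
      rfl
  · simp only
    rw [Int.add_ediv_of_dvd_right dvd_rfl, Int.ediv_self hn', Int.add_emod_right, ← mul_smul,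
      add_comm (i / n), zpow_add, zpow_one]

theorem exists_walk (x y : A) : x = y ∨ ∃ (n : ℕ) (δ : ℕ → D), T.src (δ 0) = x ∧
    T.tgt (δ n) = y ∧ ∀ r, r < n → T.tgt (δ r) = T.src (δ (r + 1)) := by
  induction T.connected x y with
  | refl => exact .inl rfl
  | tail _ hd ih =>
    obtain ⟨d, rfl, rfl⟩ := hd
    right
    rcases ih with rfl | ⟨n, δ, h0, hn, hadj⟩
    · exact ⟨0, fun _ => d, rfl, rfl, by simp⟩
    · refine ⟨n + 1, fun r => if r ≤ n then δ r else d, by simpa using h0, by simp, fun r hr => ?_⟩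
      rcases Nat.lt_succ_iff_lt_or_eq.1 hr with h | rfl
      · simp only [h.le, if_true, Nat.succ_le_of_lt h]
        exact hadj r h
      · simpa using hn

/-- Every nontrivial element has an axis: a shortest edge path from a vertex to its image
extends periodically to a path without backtracking. -/
theorem exists_isAxis (hT : T.IsFreeAction π) {g : π} (hg : g ≠ 1) [Nonempty A] :
    ∃ (c : ℤ → D) (n : ℕ), T.IsAxis g c n := by
  classical
  have hex : ∃ n : ℕ, 0 < n ∧ ∃ c : ℤ → D, (∀ i, T.tgt (c i) = T.src (c (i + 1))) ∧
      ∀ i, g • c i = c (i + n) := by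
    obtain ⟨x⟩ := ‹Nonempty A›
    rcases T.exists_walk x (g • x) with h | ⟨n, δ, h0, hn, hadj⟩
    · exact absurd (hT.eq_one_of_smul_eq g x h.symm) hg
    · exact ⟨n + 1, n.succ_pos, exists_periodic_extension hT n.succ_pos
        (fun r hr => hadj r (by omega)) (by simpa [h0] using hn)⟩
  obtain ⟨hpos, c, hadj, hsmul⟩ := Nat.find_spec hex
  set n := Nat.find hex with hn
  refine ⟨c, n, ⟨⟨hadj, fun i hi => ?_⟩, by exact_mod_cast hpos, hsmul⟩⟩
  -- A backtracking step could be removed, together with its translates.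
  have h1 : n ≠ 1 := by
    intro h1
    have := hsmul i
    rw [h1] at this
    exact hT.smul_ne_rev g (c i) (this.trans hi)
  have h2 : T.src (c (i + 2)) = T.src (c i) := by
    rw [show i + 2 = i + 1 + 1 by ring, ← hadj (i + 1), hi, T.tgt_rev]
  have h3 : n ≠ 2 := by
    intro h3
    have := hsmul i
    rw [h3] at this
    refine hg (hT.eq_one_of_smul_eq g (T.src (c i)) ?_)
    rw [← hT.src_smul, this]
    exact_mod_cast h2
  refine Nat.find_min hex (m := n - 2) (by omega) ⟨by omega,
    exists_periodic_extension hT (δ := fun r => c (i + 2 + r)) (by omega) (fun r _ => ?_) ?_⟩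
  · rw [hadj]
    congr 2
    push_cast
    ring
  · have h4 : i + 2 + ((n - 2 - 1 : ℕ) : ℤ) = i + n - 1 := by omega
    rw [h4, hadj, sub_add_cancel, ← hsmul, hT.src_smul]
    simp [h2]

/-- Let the elements `W a`, one for each vertex `a` and all conjugate to each other, depend
equivariantly on `a`, and let their axes meet all orbits of edges. Then there is a dart, with
endpoints `a` and `b`, such that one of its proper translates separates `W a ^ k • a` from
`W b ^ k • b` for all large `k`. -/
theorem exists_separating_smul (hT : T.IsFreeAction π) (hπ : ¬ IsCyclic π) (W : A → π)
    (hW : ∀ a (u : π), W (u • a) = u * W a * u⁻¹) (a₀ : A) (hconj : ∀ a, IsConj (W a₀) (W a))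
    {c : ℤ → D} {m : ℤ} (hc : T.IsAxis (W a₀) c m)
    (hcov : ∀ d, ∃ i, ∃ u : π, c i = u • d ∨ c i = u • T.rev d) :
    ∃ (d : D) (u : π), u ≠ 1 ∧ ∀ᶠ k : ℕ in atTop,
      ¬ (T.side (u • d) (W (T.src d) ^ k • T.src d) ↔
        T.side (u • d) (W (T.tgt d) ^ k • T.tgt d)) := by
  -- Otherwise `W` would be constant, hence central.
  obtain ⟨d, hd⟩ : ∃ d, W (T.src d) ≠ W (T.tgt d) := by
    by_contra! hno
    have hconst : ∀ x y, W x = W y := by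
      intro x y
      induction T.connected x y with
      | refl => rfl
      | tail _ hd ih =>
        obtain ⟨d, rfl, rfl⟩ := hd
        rw [ih, hno]
    exact hπ (hc.isCyclic_of_central hT fun u => by rw [← hW, hconst])
  obtain ⟨s, hs⟩ := isConj_iff.1 (hconj (T.src d))
  obtain ⟨t, ht⟩ := isConj_iff.1 (hconj (T.tgt d))
  have hca := hc.conj hT s
  have hcb := hc.conj hT t
  rw [hs] at hca
  rw [ht] at hcb
  -- The axes have no common end, so the darts far along the first axis separate the two orbits.
  obtain ⟨i₀, hi₀⟩ : ∃ i₀, ∀ᶠ k : ℕ in atTop,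
      ¬ T.side (s • c i₀) (W (T.tgt d) ^ k • T.tgt d) := by
    by_contra! hno
    obtain ⟨r, hr⟩ := IsAxis.exists_shift hT hca.toIsLine hcb
      fun i hev => hno i hev
    exact hd (IsAxis.eq_of_shift hT hca hcb hr)
  have hsep : ∀ i, i₀ ≤ i → ∀ᶠ k : ℕ in atTop,
      ¬ (T.side (s • c i) (W (T.src d) ^ k • T.src d) ↔
        T.side (s • c i) (W (T.tgt d) ^ k • T.tgt d)) := by
    intro i hi
    filter_upwards [hi₀, hca.eventually_side_pow_smul hT i (T.src d)] with k h1 h2 h3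
    exact h1 (hca.side_mono hi (h3.1 h2))
  -- Far along this axis there is a proper translate of `d` or of its reverse.
  obtain ⟨i, u, hiu⟩ := hcov d
  obtain ⟨j, u', hj, hu', hju⟩ : ∃ j, ∃ u' : π, i₀ ≤ j ∧ u' ≠ 1 ∧
      (s • c j = u' • d ∨ s • c j = u' • T.rev d) := by
    have hgen : ∀ k : ℕ, s • c (i + k * m) = (W (T.src d) ^ k * (s * u)) • d ∨
        s • c (i + k * m) = (W (T.src d) ^ k * (s * u)) • T.rev d := by
      intro k
      rw [← hca.pow_smul k i]
      exact hiu.imp (fun h => by rw [h, mul_smul, mul_smul])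
        (fun h => by rw [h, mul_smul, mul_smul])
    have hlarge : ∀ k : ℕ, (i₀ - i).toNat ≤ k → i₀ ≤ i + k * m := by
      intro k hk
      have h1 : i₀ - i ≤ k := Int.toNat_le.1 hk
      have h2 : (k : ℤ) ≤ k * m := le_mul_of_one_le_right (Int.natCast_nonneg k) hc.pos
      omega
    set N := (i₀ - i).toNat
    by_cases h1 : W (T.src d) ^ N * (s * u) = 1
    · refine ⟨_, _, hlarge (N + 1) (Nat.le_succ N), ?_, hgen (N + 1)⟩
      rw [pow_succ', mul_assoc, h1, mul_one]
      exact hca.ne_one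
    · exact ⟨_, _, hlarge N le_rfl, h1, hgen N⟩
  have hfin := hsep j hj
  rcases hju with h | h
  · exact ⟨d, u', hu', by rwa [h] at hfin⟩
  · refine ⟨T.rev d, u', hu', ?_⟩
    rw [h] at hfin
    filter_upwards [hfin] with k hk hk'
    rw [T.src_rev, T.tgt_rev] at hk'
    exact hk hk'.symm

end CutTree

/-! ### The topology of a graph -/

namespace Multigraph

open Topology

variable {V E : Type*} {Γ : Multigraph V E}

theorem edge_zero (e : E) : Γ.edge e 0 = Γ.vertex (Γ.src e) := Quot.sound (.src e)

theorem edge_one (e : E) : Γ.edge e 1 = Γ.vertex (Γ.tgt e) := Quot.sound (.tgt e)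

theorem isOpen_realization_iff {s : Set Γ.Realization} :
    IsOpen s ↔ ∀ e, IsOpen (Γ.edge e ⁻¹' s) := by
  rw [isOpen_iSup_iff]
  exact forall_congr' fun e => isOpen_coinduced

theorem continuous_edge (e : E) : Continuous (Γ.edge e) :=
  continuous_def.2 fun _ h => isOpen_realization_iff.1 h e

theorem continuous_realization_iff {Y : Type*} [TopologicalSpace Y] {f : Γ.Realization → Y} :
    Continuous f ↔ ∀ e, Continuous (f ∘ Γ.edge e) :=
  ⟨fun h e => h.comp (continuous_edge e), fun h => continuous_def.2 fun _ hs =>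
    isOpen_realization_iff.2 fun e => hs.preimage (h e)⟩

theorem realization_cases (x : Γ.Realization) :
    (∃ v, x = Γ.vertex v) ∨ ∃ e, ∃ t : I, t ≠ 0 ∧ t ≠ 1 ∧ x = Γ.edge e t := by
  obtain ⟨v | ⟨e, t⟩, rfl⟩ := Quot.exists_rep x
  · exact .inl ⟨v, rfl⟩
  · by_cases h0 : t = 0
    · exact .inl ⟨_, by rw [h0]; exact edge_zero e⟩
    · by_cases h1 : t = 1
      · exact .inl ⟨_, by rw [h1]; exact edge_one e⟩
      · exact .inr ⟨e, t, h0, h1, rfl⟩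

/-- The affine extension of a function on the vertices. -/
noncomputable def interpolate (g : V → ℝ) : Γ.Realization → ℝ :=
  Quot.lift (Sum.elim g fun q => (1 - (q.2 : ℝ)) * g (Γ.src q.1) + q.2 * g (Γ.tgt q.1)) (by
    rintro _ _ (e | e) <;> simp)

theorem continuous_interpolate (g : V → ℝ) : Continuous (interpolate (Γ := Γ) g) :=
  continuous_realization_iff.2 fun e => by
    change Continuous fun t : I => (1 - (t : ℝ)) * g (Γ.src e) + t * g (Γ.tgt e)
    fun_prop

open Classical in
/-- The map to the circle that collapses the complement of the open edge `e` to a point. -/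
noncomputable def collapse (e : E) : Γ.Realization → AddCircle (1 : ℝ) :=
  Quot.lift
    (Sum.elim (fun _ => 0) fun q => if q.1 = e then ((q.2 : ℝ) : AddCircle (1 : ℝ)) else 0)
    (by rintro _ _ (e | e) <;> simp)

theorem collapse_vertex (e : E) (v : V) : collapse e (Γ.vertex v) = 0 := rfl

theorem collapse_edge (e : E) (t : I) : collapse e (Γ.edge e t) = ((t : ℝ) : AddCircle (1 : ℝ)) :=
  if_pos rfl

theorem collapse_edge_of_ne {e e' : E} (h : e' ≠ e) (t : I) : collapse e (Γ.edge e' t) = 0 :=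
  if_neg h

theorem continuous_collapse (e : E) : Continuous (collapse (Γ := Γ) e) :=
  continuous_realization_iff.2 fun e' => by
    by_cases h : e' = e
    · subst h
      rw [show collapse e' ∘ Γ.edge e' = fun t : I => ((t : ℝ) : AddCircle (1 : ℝ)) from
        funext (collapse_edge e')]
      exact (AddCircle.continuous_mk' 1).comp continuous_subtype_val
    · rw [show collapse e ∘ Γ.edge e' = fun _ => 0 from funext (collapse_edge_of_ne h)]
      exact continuous_const

theorem coe_addCircle_inj {s t : I} (hs0 : s ≠ 0) (hs1 : s ≠ 1)
    (h : ((s : ℝ) : AddCircle (1 : ℝ)) = ((t : ℝ) : AddCircle (1 : ℝ))) : s = t := by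
  have h' : (((s : ℝ) - t : ℝ) : AddCircle (1 : ℝ)) = 0 := by
    rw [AddCircle.coe_sub, h, sub_self]
  obtain ⟨n, hn⟩ := (AddCircle.coe_eq_zero_iff 1).1 h'
  rw [zsmul_one] at hn
  have h0 := unitInterval.coe_pos.2 (unitInterval.pos_iff_ne_zero.2 hs0)
  have h1 := unitInterval.coe_lt_one.2 (unitInterval.lt_one_iff_ne_one.2 hs1)
  have hn1 : (n : ℝ) < 1 := by linarith [t.2.1]
  have hn2 : (-1 : ℝ) < n := by linarith [t.2.2]
  have hn3 : n = 0 := by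
    have : n < 1 := by exact_mod_cast hn1
    have : -1 < n := by exact_mod_cast hn2
    omega
  rw [hn3, Int.cast_zero] at hn
  exact Subtype.ext (by linarith)

theorem edge_ne_vertex (e : E) {t : I} (h0 : t ≠ 0) (h1 : t ≠ 1) (v : V) :
    Γ.edge e t ≠ Γ.vertex v := by
  intro h
  have h2 := congrArg (collapse e) h
  rw [collapse_edge, collapse_vertex] at h2
  exact h0 (coe_addCircle_inj h0 h1 (by simpa using h2))

theorem edge_eq_edge {e e' : E} {t t' : I} (h0 : t ≠ 0) (h1 : t ≠ 1)
    (h : Γ.edge e t = Γ.edge e' t') : e' = e ∧ t = t' := by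
  have h2 := congrArg (collapse e) h
  rw [collapse_edge] at h2
  by_cases he : e' = e
  · subst he
    rw [collapse_edge] at h2
    exact ⟨rfl, coe_addCircle_inj h0 h1 h2⟩
  · rw [collapse_edge_of_ne he] at h2
    exact absurd (coe_addCircle_inj (t := 0) h0 h1 (by simpa using h2)) h0

instance : T2Space Γ.Realization where
  t2 x y hxy := by
    classical
    have hcol : ∀ (e : E) (t : I) (z : Γ.Realization), t ≠ 0 → t ≠ 1 → Γ.edge e t ≠ z →
        collapse e (Γ.edge e t) ≠ collapse e z := by
      intro e t z h0 h1 hz h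
      rw [collapse_edge] at h
      rcases realization_cases z with ⟨v, rfl⟩ | ⟨e', t', h0', h1', rfl⟩
      · exact h0 (coe_addCircle_inj h0 h1 (by simpa [collapse_vertex] using h))
      · by_cases he : e' = e
        · subst he
          rw [collapse_edge] at h
          exact hz (by rw [coe_addCircle_inj h0 h1 h])
        · rw [collapse_edge_of_ne he] at h
          exact h0 (coe_addCircle_inj h0 h1 (by simpa using h))
    rcases realization_cases x with ⟨v, rfl⟩ | ⟨e, t, h0, h1, rfl⟩
    · rcases realization_cases y with ⟨v', rfl⟩ | ⟨e, t, h0, h1, rfl⟩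
      · refine separated_by_continuous
          (continuous_interpolate fun u => if u = v then (1 : ℝ) else 0) ?_
        change (if v = v then (1 : ℝ) else 0) ≠ if v' = v then (1 : ℝ) else 0
        have : v' ≠ v := fun h => hxy (by rw [h])
        simp [this]
      · exact separated_by_continuous (continuous_collapse e) (hcol e t _ h0 h1 hxy.symm).symm
    · exact separated_by_continuous (continuous_collapse e) (hcol e t _ h0 h1 hxy)

instance : LocallyPathConnectedSpace I :=
  (convex_Icc (0 : ℝ) 1).locallyPathConnectedSpace

instance : LocallyPathConnectedSpace Γ.Realization := by
  refine locallyPathConnectedSpace_iff_isOpen_pathComponentIn.2 fun y u hu =>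
    isOpen_realization_iff.2 fun e => isOpen_iff_mem_nhds.2 fun t ht => ?_
  have ht' : t ∈ Γ.edge e ⁻¹' u := Set.preimage_mono pathComponentIn_subset ht
  refine Filter.mem_of_superset ((hu.preimage (continuous_edge e)).pathComponentIn t |>.mem_nhds
    (mem_pathComponentIn_self ht')) ?_
  refine Set.image_subset_iff (f := Γ.edge e).1 ?_
  rw [← pathComponentIn_congr (show Γ.edge e t ∈ pathComponentIn u y from ht)]
  exact ((isPathConnected_pathComponentIn ht').image (continuous_edge e)).subset_pathComponentIn
    ⟨t, mem_pathComponentIn_self ht', rfl⟩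
    ((Set.image_mono pathComponentIn_subset).trans (u.image_preimage_subset _))

instance : SimplyConnectedSpace I :=
  have := (convex_Icc (0 : ℝ) 1).contractibleSpace ⟨0, by simp⟩
  inferInstanceAs (SimplyConnectedSpace (Set.Icc (0 : ℝ) 1))

theorem continuous_dart (d : E × Bool) : Continuous (Γ.dart d) := by
  obtain ⟨e, b⟩ := d
  cases b
  · exact (continuous_edge e).comp unitInterval.continuous_symm
  · exact continuous_edge e

theorem dart_not (d : E × Bool) (t : I) : Γ.dart (d.1, !d.2) t = Γ.dart d (σ t) := by
  obtain ⟨e, b⟩ := d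
  cases b <;> simp [dart]

end Multigraph

/-! ### Coverings and their deck groups -/

section Covering

open Set Topology

/-- A space that admits a local homeomorphism to a locally path connected space is locally path
connected. -/
theorem IsLocalHomeomorph.locallyPathConnectedSpace {X Y : Type*} [TopologicalSpace X]
    [TopologicalSpace Y] [LocallyPathConnectedSpace Y] {p : X → Y} (hp : IsLocalHomeomorph p) :
    LocallyPathConnectedSpace X where
  path_connected_basis x := Filter.hasBasis_self.2 fun N hN => by
    obtain ⟨U, hU, he⟩ := isLocalHomeomorph_iff_isOpenEmbedding_restrict.1 hp x
    have := he.locallyPathConnectedSpace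
    have hxU := mem_of_mem_nhds hU
    obtain ⟨s, ⟨hs, hsc⟩, hsN⟩ := (path_connected_basis (⟨x, hxU⟩ : U)).mem_iff.1
      (continuous_subtype_val.continuousAt.preimage_mem_nhds hN)
    refine ⟨Subtype.val '' s, ?_, hsc.image continuous_subtype_val, image_subset_iff.2 hsN⟩
    rw [← map_nhds_subtype_coe_eq_nhds hxU hU]
    exact Filter.image_mem_map hs

variable {X Y : Type*} [TopologicalSpace X] [TopologicalSpace Y] {p : X → Y}

instance : MulAction (deckGroup p) X where
  smul γ x := (γ : X ≃ₜ X) x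
  one_smul _ := rfl
  mul_smul _ _ _ := rfl

omit [TopologicalSpace Y] in
theorem map_deckGroup_smul (γ : deckGroup p) (x : X) : p (γ • x) = p x := γ.2 x

omit [TopologicalSpace Y] in
theorem continuous_deckGroup_smul (γ : deckGroup p) : Continuous fun x : X => γ • x :=
  (γ : X ≃ₜ X).continuous

theorem deckGroup_eq_one_of_smul_eq [PreconnectedSpace X] (hp : IsCoveringMap p) {γ : deckGroup p}
    {x : X} (h : γ • x = x) : γ = 1 := by
  have h1 : (fun y : X => γ • y) = id := hp.eq_of_comp_eq (continuous_deckGroup_smul γ)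
    continuous_id (funext fun y => map_deckGroup_smul γ y) x h
  exact Subtype.ext (Homeomorph.ext fun y => congrFun h1 y)

theorem exists_deckGroup_smul_eq [SimplyConnectedSpace X] [LocallyPathConnectedSpace X]
    (hp : IsCoveringMap p) {x y : X} (h : p x = p y) : ∃ γ : deckGroup p, γ • x = y := by
  have key : ∀ {x y : X}, p x = p y → ∃ F : C(X, X), F x = y ∧ p ∘ F = p := fun {x y} h =>
    (hp.existsUnique_continuousMap_lifts ⟨p, hp.continuous⟩ x y h.symm).exists
  have inv : ∀ {x y : X} {F G : C(X, X)}, F x = y → p ∘ F = p → G y = x → p ∘ G = p →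
      ∀ z, G (F z) = z := by
    intro x y F G h1 h2 h3 h4 z
    refine congrFun (hp.eq_of_comp_eq (G.comp F).continuous continuous_id ?_ x (by simp [h1, h3])) z
    rw [ContinuousMap.coe_comp, ← Function.comp_assoc, h4, h2, Function.comp_id]
  obtain ⟨F, hF, hpF⟩ := key h
  obtain ⟨G, hG, hpG⟩ := key h.symm
  exact ⟨⟨⟨⟨F, G, inv hF hpF hG hpG, inv hG hpG hF hpF⟩, F.continuous, G.continuous⟩,
    fun z => congrFun hpF z⟩, hF⟩

theorem isQuotientCoveringMap_deckGroup [SimplyConnectedSpace X] [LocallyPathConnectedSpace X]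
    (hp : IsCoveringMap p) (hsurj : Function.Surjective p) :
    IsQuotientCoveringMap p (deckGroup p) := by
  refine (isQuotientCoveringMap_iff_isCoveringMap_and ..).2
    ⟨hp, hsurj, ⟨continuous_deckGroup_smul⟩, ?_, fun {x y} => ⟨fun h => ?_, ?_⟩⟩
  · refine { left_cancel' := fun γ x y h => smul_left_cancel γ h
             right_cancel' := fun γ γ' x h => ?_ }
    have h1 : (γ'⁻¹ * γ) • x = x := by rw [mul_smul, h, inv_smul_smul]
    exact (inv_mul_eq_one.1 (deckGroup_eq_one_of_smul_eq hp h1)).symm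
  · exact exists_deckGroup_smul_eq hp h.symm
  · rintro ⟨γ, rfl⟩
    exact map_deckGroup_smul γ y

theorem isCyclic_fundamentalGroup [SimplyConnectedSpace X] [LocallyPathConnectedSpace X]
    (hp : IsCoveringMap p) (hsurj : Function.Surjective p) [IsCyclic (deckGroup p)] (y : Y) :
    IsCyclic (FundamentalGroup Y y) := by
  obtain ⟨x, hx⟩ := hsurj y
  let e := (isQuotientCoveringMap_deckGroup hp hsurj).fundamentalGroupEquiv ⟨x, hx⟩
  let e' := (MulEquiv.inv' (deckGroup p)).trans e.symm
  exact isCyclic_of_surjective e' e'.surjective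

theorem IsCoveringMap.t2Space (hp : IsCoveringMap p) [T2Space Y] : T2Space X where
  t2 x y hxy := by
    by_cases h : p x = p y
    · exact hp.isSeparatedMap x y h hxy
    · exact separated_by_continuous hp.continuous h

theorem IsCoveringMap.surjective (hp : IsCoveringMap p) [Nonempty X] [PathConnectedSpace Y] :
    Function.Surjective p := fun y => by
  obtain ⟨x⟩ := ‹Nonempty X›
  let γ := PathConnectedSpace.somePath (p x) y
  obtain ⟨δ, hδ, -⟩ := hp.exists_path_lifts (γ : C(I, Y)) x γ.source
  exact ⟨δ 1, (congrFun hδ 1).trans γ.target⟩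

namespace IsEquivariantLift

variable {f : Y → Y} {F : X → X}

omit [TopologicalSpace Y]

theorem map_smul (hF : IsEquivariantLift p f F) (γ : deckGroup p) (x : X) :
    F (γ • x) = γ • F x := hF.comm γ γ.2 x

theorem iterate (hF : IsEquivariantLift p f F) (n : ℕ) : IsEquivariantLift p f^[n] F^[n] where
  lift x := (Function.Semiconj.iterate_right (f := p) hF.lift n) x
  comm γ hγ x := (Function.Commute.iterate_left (f := F) (g := γ) (hF.comm γ hγ) n) x

theorem iterate_eq_pow_smul (hF : IsEquivariantLift p f F) {γ : deckGroup p} {x : X}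
    (h : F x = γ • x) (n : ℕ) : F^[n] x = γ ^ n • x := by
  induction n with
  | zero => simp
  | succ n ih => rw [Function.iterate_succ_apply', ih, hF.map_smul, h, pow_succ, mul_smul]

theorem apply_eq_conj_smul (hF : IsEquivariantLift p f F) {γ : deckGroup p} {x : X}
    (h : F x = γ • x) (δ : deckGroup p) : F (δ • x) = (δ * γ * δ⁻¹) • δ • x := by
  rw [hF.map_smul, h, mul_smul, mul_smul, inv_smul_smul]

end IsEquivariantLift

/-- Points of one orbit have the same rotation element. -/
theorem IsEquivariantLift.sameRotation [SimplyConnectedSpace X] [LocallyPathConnectedSpace X]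
    (hp : IsCoveringMap p) {f : Y → Y} {F : X → X} (hF : IsEquivariantLift p f F)
    {x y : X} {γ δ : deckGroup p} {m n k : ℕ} (hx : F^[m] x = γ • x) (hy : F^[n] y = δ • y)
    (hxy : f^[k] (p x) = p y) : SameRotation γ m δ n := by
  obtain ⟨ε, hε⟩ := exists_deckGroup_smul_eq hp (((hF.iterate k).lift x).trans hxy)
  have h1 : F^[m] (F^[k] x) = γ • F^[k] x := by
    rw [← Function.iterate_add_apply, add_comm, Function.iterate_add_apply, hx,
      (hF.iterate k).map_smul]
  have h2 := (hF.iterate m).apply_eq_conj_smul h1 ε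
  rw [hε] at h2
  have h3 := (hF.iterate m).iterate_eq_pow_smul h2 n
  have h4 := (hF.iterate n).iterate_eq_pow_smul hy m
  rw [← Function.iterate_mul, mul_comm, Function.iterate_mul, h4, conj_pow] at h3
  refine isConj_iff.2 ⟨ε, ?_⟩
  have h5 : ((ε * γ ^ n * ε⁻¹)⁻¹ * δ ^ m) • y = y := by rw [mul_smul, h3, inv_smul_smul]
  exact inv_mul_eq_one.1 (deckGroup_eq_one_of_smul_eq hp h5)

end Covering

/-! ### Lifted edges -/

namespace Multigraph

open Set Topology

variable {V E X : Type*} {Γ : Multigraph V E} [TopologicalSpace X]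

/-- A lift of a directed edge to the total space of the map `p`. -/
@[ext]
structure LiftedDart (p : X → Γ.Realization) where
  base : E × Bool
  path : C(I, X)
  lift : ∀ t, p (path t) = Γ.dart base t

/-- A point of the total space of `p` over a vertex. -/
abbrev LiftedVertex (p : X → Γ.Realization) : Type _ := {x : X // ∃ v, p x = Γ.vertex v}

theorem dart_zero_mem (d : E × Bool) : ∃ v, Γ.dart d 0 = Γ.vertex v := by
  obtain ⟨e, b⟩ := d
  cases b
  · exact ⟨_, by simp only [dart, unitInterval.symm_zero]; exact edge_one e⟩
  · exact ⟨_, edge_zero e⟩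

theorem dart_one_mem (d : E × Bool) : ∃ v, Γ.dart d 1 = Γ.vertex v := by
  obtain ⟨v, hv⟩ := dart_zero_mem (Γ := Γ) (d.1, !d.2)
  exact ⟨v, by rw [← hv, dart_not, unitInterval.symm_zero]⟩

theorem dart_ne_vertex (d : E × Bool) {t : I} (h0 : t ≠ 0) (h1 : t ≠ 1) (v : V) :
    Γ.dart d t ≠ Γ.vertex v := by
  obtain ⟨e, b⟩ := d
  cases b
  · exact edge_ne_vertex e (fun h => h1 (by rw [← unitInterval.symm_symm t, h]; simp))
      (fun h => h0 (by rw [← unitInterval.symm_symm t, h]; simp)) v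
  · exact edge_ne_vertex e h0 h1 v

theorem dart_eq_dart {d d' : E × Bool} {t t' : I} (h0 : t ≠ 0) (h1 : t ≠ 1)
    (h : Γ.dart d t = Γ.dart d' t') :
    d' = d ∧ t' = t ∨ d' = (d.1, !d.2) ∧ t' = σ t := by
  have h0' : σ t ≠ 0 := fun h => h1 (by rw [← unitInterval.symm_symm t, h]; simp)
  have h1' : σ t ≠ 1 := fun h => h0 (by rw [← unitInterval.symm_symm t, h]; simp)
  obtain ⟨e, b⟩ := d
  obtain ⟨e', b'⟩ := d'
  cases b <;> cases b'
  · obtain ⟨rfl, h2⟩ := edge_eq_edge h0' h1' h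
    exact .inl ⟨rfl, (unitInterval.symm_inj.1 h2).symm⟩
  · obtain ⟨rfl, h2⟩ := edge_eq_edge h0' h1' h
    exact .inr ⟨rfl, h2.symm⟩
  · obtain ⟨rfl, h2⟩ := edge_eq_edge h0 h1 h
    exact .inr ⟨rfl, by rw [h2, unitInterval.symm_symm]⟩
  · obtain ⟨rfl, h2⟩ := edge_eq_edge h0 h1 h
    exact .inl ⟨rfl, h2.symm⟩

/-- The coordinate along a directed edge, as a map from the graph to the circle that collapses
the complement of the open edge to a point. -/
noncomputable def dartCoord (d : E × Bool) (x : Γ.Realization) : AddCircle (1 : ℝ) :=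
  if d.2 then collapse d.1 x else -collapse d.1 x

theorem continuous_dartCoord (d : E × Bool) : Continuous (dartCoord (Γ := Γ) d) := by
  obtain ⟨e, b⟩ := d
  cases b
  · exact (continuous_collapse e).neg
  · exact continuous_collapse e

theorem dartCoord_dart (d : E × Bool) (t : I) :
    dartCoord d (Γ.dart d t) = ((t : ℝ) : AddCircle (1 : ℝ)) := by
  obtain ⟨e, b⟩ := d
  cases b
  · change -collapse e (Γ.edge e (σ t)) = _
    rw [collapse_edge, unitInterval.coe_symm_eq, AddCircle.coe_sub, AddCircle.coe_period]
    simp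
  · exact collapse_edge (Γ := Γ) e t

namespace LiftedDart

variable {p : X → Γ.Realization}

def src (c : LiftedDart p) : LiftedVertex p :=
  ⟨c.path 0, by simpa only [c.lift] using dart_zero_mem c.base⟩

def tgt (c : LiftedDart p) : LiftedVertex p :=
  ⟨c.path 1, by simpa only [c.lift] using dart_one_mem c.base⟩

def rev (c : LiftedDart p) : LiftedDart p where
  base := (c.base.1, !c.base.2)
  path := c.path.comp ⟨σ, unitInterval.continuous_symm⟩
  lift t := by
    rw [dart_not]
    exact c.lift (σ t)

theorem rev_path (c : LiftedDart p) (t : I) : c.rev.path t = c.path (σ t) := rfl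

theorem rev_rev (c : LiftedDart p) : c.rev.rev = c := by
  refine LiftedDart.ext (by simp [rev]) (ContinuousMap.ext fun t => ?_)
  rw [rev_path, rev_path, unitInterval.symm_symm]

theorem src_rev (c : LiftedDart p) : c.rev.src = c.tgt :=
  Subtype.ext (by simp [src, tgt, rev_path])

theorem tgt_rev (c : LiftedDart p) : c.rev.tgt = c.src :=
  Subtype.ext (by simp [src, tgt, rev_path])

theorem eq_src_or_eq_tgt {c : LiftedDart p} {t : I} {b : LiftedVertex p} (h : c.path t = b.1) :
    b = c.src ∨ b = c.tgt := by
  obtain ⟨v, hv⟩ := b.2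
  by_cases h0 : t = 0
  · exact .inl (Subtype.ext (by rw [← h, h0]; rfl))
  by_cases h1 : t = 1
  · exact .inr (Subtype.ext (by rw [← h, h1]; rfl))
  rw [← h, c.lift] at hv
  exact absurd hv (dart_ne_vertex _ h0 h1 v)

section Covering

variable (hp : IsCoveringMap p)
include hp

theorem eq_of_path_eq {c c' : LiftedDart p} (hb : c.base = c'.base) {t : I}
    (h : c.path t = c'.path t) : c = c' :=
  LiftedDart.ext hb (DFunLike.coe_injective (hp.eq_of_comp_eq c.path.continuous c'.path.continuous
    (funext fun s => by simp only [Function.comp_apply]; rw [c.lift, c'.lift, hb]) t h))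

/-- Two lifted edges that share an interior point agree up to direction. -/
theorem eq_or_eq_rev {c c' : LiftedDart p} {t t' : I} (h0 : t ≠ 0) (h1 : t ≠ 1)
    (h : c.path t = c'.path t') : c' = c ∨ c' = c.rev := by
  have h2 := congrArg p h
  rw [c.lift, c'.lift] at h2
  rcases dart_eq_dart h0 h1 h2 with ⟨hb, rfl⟩ | ⟨hb, rfl⟩
  · exact .inl (eq_of_path_eq hp hb h.symm)
  · refine .inr (eq_of_path_eq hp (t := σ t) hb ?_)
    rw [rev_path, unitInterval.symm_symm, h]

theorem exists_through {d : E × Bool} {t : I} {x : X} (hx : p x = Γ.dart d t) :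
    ∃ c : LiftedDart p, c.base = d ∧ c.path t = x := by
  obtain ⟨F, hF, hpF⟩ := (hp.existsUnique_continuousMap_lifts
    (⟨Γ.dart d, continuous_dart d⟩ : C(I, Γ.Realization)) t x hx).exists
  exact ⟨⟨d, F, fun s => congrFun hpF s⟩, rfl, hF⟩

/-- The total space of a covering of a graph carries the weak topology with respect to the
lifted edges. -/
theorem isOpen_iff {U : Set X} : IsOpen U ↔ ∀ c : LiftedDart p, IsOpen (c.path ⁻¹' U) := by
  refine ⟨fun h c => h.preimage c.path.continuous, fun h => isOpen_iff_mem_nhds.2 fun x hx => ?_⟩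
  obtain ⟨e, hxe, hpe⟩ := hp.isLocalHomeomorph x
  have hW : IsOpen (p '' (U ∩ e.source)) := by
    refine isOpen_realization_iff.2 fun e' => isOpen_iff_mem_nhds.2 ?_
    rintro t ⟨y, ⟨hyU, hye⟩, hy⟩
    obtain ⟨c, hc, hcy⟩ := exists_through hp (d := (e', true)) (t := t) hy
    have hopen := (h c).inter (e.open_source.preimage c.path.continuous)
    refine Filter.mem_of_superset (hopen.mem_nhds ⟨?_, ?_⟩) ?_
    · rwa [mem_preimage, hcy]
    · rwa [mem_preimage, hcy]
    · rintro s ⟨hs1, hs2⟩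
      refine ⟨c.path s, ⟨hs1, hs2⟩, ?_⟩
      rw [c.lift, hc]
      rfl
  have hmem : e.source ∩ p ⁻¹' (p '' (U ∩ e.source)) ∈ 𝓝 x :=
    Filter.inter_mem (e.open_source.mem_nhds hxe)
      ((hW.preimage hp.continuous).mem_nhds ⟨x, ⟨hx, hxe⟩, rfl⟩)
  refine Filter.mem_of_superset hmem ?_
  rintro y ⟨hy, z, ⟨hzU, hze⟩, hzy⟩
  rw [hpe] at hzy
  rwa [← e.injOn hze hy hzy]

theorem continuous_iff {Y : Type*} [TopologicalSpace Y] {f : X → Y} :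
    Continuous f ↔ ∀ c : LiftedDart p, Continuous (f ∘ c.path) :=
  ⟨fun h c => h.comp c.path.continuous, fun h => continuous_def.2 fun _ hs =>
    (isOpen_iff hp).2 fun c => hs.preimage (h c)⟩

/-- Any two vertices of a connected covering are joined by an edge path. -/
theorem reflTransGen [PreconnectedSpace X] (a b : LiftedVertex p) :
    Relation.ReflTransGen (fun x y => ∃ c : LiftedDart p, c.src = x ∧ c.tgt = y) a b := by
  set R := fun x y => ∃ c : LiftedDart p, c.src = x ∧ c.tgt = y
  have hfwd : ∀ c : LiftedDart p, R c.src c.tgt := fun c => ⟨c, rfl, rfl⟩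
  have hbwd : ∀ c : LiftedDart p, R c.tgt c.src := fun c => ⟨c.rev, c.src_rev, c.tgt_rev⟩
  let U : Set X := {x | x = a.1 ∨ ∃ c : LiftedDart p, x ∈ range c.path ∧
    Relation.ReflTransGen R a c.src}
  -- The set of points that can be reached contains a lifted edge as soon as it meets it.
  have hvert : ∀ (c : LiftedDart p) (t : I) (b' : LiftedVertex p), c.path t = b'.1 →
      Relation.ReflTransGen R b' c.src ∧ Relation.ReflTransGen R c.src b' := by
    intro c t b' h
    rcases eq_src_or_eq_tgt h with rfl | rfl
    · exact ⟨.refl, .refl⟩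
    · exact ⟨.single (hbwd c), .single (hfwd c)⟩
  have hU : ∀ (c : LiftedDart p) (t : I), c.path t ∈ U → Relation.ReflTransGen R a c.src := by
    rintro c t (h | ⟨c', ⟨t', ht'⟩, hc'⟩)
    · exact (hvert c t a h).1
    · by_cases ht : t = 0 ∨ t = 1
      · obtain ⟨b', hb'⟩ : ∃ b' : LiftedVertex p, c.path t = b'.1 := by
          rcases ht with rfl | rfl
          exacts [⟨c.src, rfl⟩, ⟨c.tgt, rfl⟩]
        exact (hc'.trans (hvert c' t' b' (ht'.trans hb')).2).trans (hvert c t b' hb').1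
      · push Not at ht
        rcases eq_or_eq_rev hp ht.1 ht.2 ht'.symm with rfl | rfl
        · exact hc'
        · rw [src_rev] at hc'
          exact hc'.tail (hbwd c)
  have hpre : ∀ c : LiftedDart p, c.path ⁻¹' U = ∅ ∨ c.path ⁻¹' U = univ := by
    intro c
    by_cases hc : Relation.ReflTransGen R a c.src
    · exact .inr (eq_univ_of_forall fun t => .inr ⟨c, mem_range_self t, hc⟩)
    · exact .inl (eq_empty_of_forall_notMem fun t ht => hc (hU c t ht))
  have hclopen : IsClopen U := by
    refine ⟨isOpen_compl_iff.1 ((isOpen_iff hp).2 fun c => ?_), (isOpen_iff hp).2 fun c => ?_⟩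
    · rw [preimage_compl]
      rcases hpre c with h | h <;> simp [h]
    · rcases hpre c with h | h <;> simp [h]
  have hb : b.1 ∈ U := by
    rw [hclopen.eq_univ ⟨a.1, .inl rfl⟩]
    exact mem_univ _
  rcases hb with hb | ⟨c, ⟨t, ht⟩, hc⟩
  · rw [Subtype.ext hb]
  · exact hc.trans (hvert c t b ht).2

end Covering

/-! ### The tree structure of the universal covering -/

theorem path_zero (c : LiftedDart p) : c.path 0 = c.src.1 := rfl

theorem path_one (c : LiftedDart p) : c.path 1 = c.tgt.1 := rfl

open Classical in
/-- The map to the circle that collapses the complement of an open lifted edge to a point. -/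
noncomputable def toCircle (c : LiftedDart p) (x : X) : AddCircle (1 : ℝ) :=
  if x ∈ range c.path then dartCoord c.base (p x) else 0

theorem toCircle_path (c : LiftedDart p) (t : I) :
    c.toCircle (c.path t) = ((t : ℝ) : AddCircle (1 : ℝ)) := by
  rw [toCircle, if_pos (mem_range_self t), c.lift, dartCoord_dart]

theorem toCircle_path_of_ne (hp : IsCoveringMap p) {c c' : LiftedDart p} (h : c' ≠ c)
    (h' : c' ≠ c.rev) (t : I) : c.toCircle (c'.path t) = 0 := by
  by_cases ht : c'.path t ∈ range c.path
  · obtain ⟨s, hs⟩ := ht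
    rw [← hs, toCircle_path]
    by_cases h0 : s = 0
    · simp [h0]
    by_cases h1 : s = 1
    · simp [h1]
    exact absurd (eq_or_eq_rev hp h0 h1 hs) (by tauto)
  · exact if_neg ht

theorem continuous_toCircle (hp : IsCoveringMap p) (c : LiftedDart p) : Continuous c.toCircle := by
  refine (continuous_iff hp).2 fun c' => ?_
  have hpos : range c'.path = range c.path → Continuous (c.toCircle ∘ c'.path) := by
    intro h
    have h1 : c.toCircle ∘ c'.path = dartCoord c.base ∘ p ∘ c'.path := funext fun t =>
      if_pos (h ▸ mem_range_self t)
    rw [h1]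
    exact (continuous_dartCoord _).comp (hp.continuous.comp c'.path.continuous)
  by_cases h : c' = c
  · exact hpos (by rw [h])
  by_cases h' : c' = c.rev
  · refine hpos ?_
    rw [h']
    exact (Function.Involutive.surjective unitInterval.symm_symm).range_comp c.path
  rw [show c.toCircle ∘ c'.path = fun _ => 0 from funext (toCircle_path_of_ne hp h h')]
  exact continuous_const

section Height

variable [SimplyConnectedSpace X] [LocallyPathConnectedSpace X]

theorem exists_height (hp : IsCoveringMap p) (c : LiftedDart p) :
    ∃ θ : C(X, ℝ), θ (c.path 0) = 0 ∧ ∀ x, ((θ x : ℝ) : AddCircle (1 : ℝ)) = c.toCircle x := by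
  obtain ⟨θ, h0, h⟩ := ((AddCircle.isCoveringMap_coe (1 : ℝ)).existsUnique_continuousMap_lifts
    (⟨c.toCircle, continuous_toCircle hp c⟩ : C(X, AddCircle (1 : ℝ))) (c.path 0) 0
    (by simp [toCircle_path])).exists
  exact ⟨θ, h0, fun x => congrFun h x⟩

/-- The lift of `toCircle` to the real line. It collapses the two components of the complement of
the open lifted edge `c` to the points `0` and `1`, see `height_path` and `height_cases`. -/
noncomputable def height (hp : IsCoveringMap p) (c : LiftedDart p) : C(X, ℝ) :=
  (exists_height hp c).choose

variable (hp : IsCoveringMap p)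

theorem coe_height (c : LiftedDart p) (x : X) :
    ((c.height hp x : ℝ) : AddCircle (1 : ℝ)) = c.toCircle x :=
  (exists_height hp c).choose_spec.2 x

theorem height_unique (c : LiftedDart p) {θ : X → ℝ} (hθ : Continuous θ) (h0 : θ (c.path 0) = 0)
    (h : ∀ x, ((θ x : ℝ) : AddCircle (1 : ℝ)) = c.toCircle x) : θ = c.height hp :=
  (AddCircle.isCoveringMap_coe (1 : ℝ)).eq_of_comp_eq hθ (c.height hp).continuous
    (funext fun x => (h x).trans (coe_height hp c x).symm) (c.path 0)
    (h0.trans (exists_height hp c).choose_spec.1.symm)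

theorem height_path (c : LiftedDart p) (t : I) : c.height hp (c.path t) = t := by
  refine congrFun ((AddCircle.isCoveringMap_coe (1 : ℝ)).eq_of_comp_eq
    ((c.height hp).continuous.comp c.path.continuous) continuous_subtype_val
    (funext fun s => ?_) 0 ?_) t
  · exact (coe_height hp c _).trans (toCircle_path c s)
  · exact (exists_height hp c).choose_spec.1

theorem height_mem_or (c : LiftedDart p) (x : X) :
    x ∈ range c.path ∨ ∃ n : ℤ, c.height hp x = n := by
  by_cases hx : x ∈ range c.path
  · exact .inl hx
  · have h := coe_height hp c x
    rw [toCircle, if_neg hx, AddCircle.coe_eq_zero_iff] at h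
    obtain ⟨n, hn⟩ := h
    exact .inr ⟨n, by rw [← hn, zsmul_one]⟩

/-- The height takes values in the unit interval: it would have to cross a non-integral value
outside. -/
theorem height_mem (c : LiftedDart p) (x : X) : c.height hp x ∈ Icc (0 : ℝ) 1 := by
  have hmid : ∀ r : ℝ, r ∈ range (c.height hp) → r ∈ Icc (0 : ℝ) 1 ∨ ∃ n : ℤ, r = n := by
    rintro _ ⟨y, rfl⟩
    rcases height_mem_or hp c y with ⟨t, rfl⟩ | h
    · rw [height_path]
      exact .inl t.2
    · exact .inr h
  have h0 : c.height hp (c.path 0) = 0 := height_path hp c 0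
  constructor
  · by_contra! hneg
    rcases hmid (max (c.height hp x) (-1 / 2)) (mem_range_of_exists_le_of_exists_ge
      (c.height hp).continuous ⟨x, le_max_left _ _⟩ ⟨c.path 0, by
        rw [h0]; exact max_le hneg.le (by norm_num)⟩) with h | ⟨n, hn⟩
    · exact absurd h.1 (not_le.2 (max_lt hneg (by norm_num)))
    · have h1 : (n : ℝ) < 0 := hn ▸ max_lt hneg (by norm_num)
      have h2 : (-1 : ℝ) < n := hn ▸ lt_of_lt_of_le (by norm_num) (le_max_right _ _)
      have h3 : n < 0 := by exact_mod_cast h1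
      have h4 : -1 < n := by exact_mod_cast h2
      omega
  · by_contra! hpos
    rcases hmid (min (c.height hp x) (3 / 2)) (mem_range_of_exists_le_of_exists_ge
      (c.height hp).continuous ⟨c.path 0, by
        rw [h0]; exact le_min (by linarith) (by norm_num)⟩ ⟨x, min_le_left _ _⟩) with h | ⟨n, hn⟩
    · exact absurd h.2 (not_le.2 (lt_min hpos (by norm_num)))
    · have h1 : (1 : ℝ) < n := hn ▸ lt_min hpos (by norm_num)
      have h2 : (n : ℝ) < 2 := hn ▸ lt_of_le_of_lt (min_le_right _ _) (by norm_num)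
      have h3 : 1 < n := by exact_mod_cast h1
      have h4 : n < 2 := by exact_mod_cast h2
      omega

theorem height_cases (c : LiftedDart p) (x : X) :
    c.height hp x = 0 ∨ c.height hp x = 1 ∨ x ∈ range c.path := by
  rcases height_mem_or hp c x with h | ⟨n, hn⟩
  · exact .inr (.inr h)
  · have h := height_mem hp c x
    rw [hn] at h
    have h1 : 0 ≤ n := by exact_mod_cast h.1
    have h2 : n ≤ 1 := by exact_mod_cast h.2
    obtain rfl | rfl : n = 0 ∨ n = 1 := by omega
    · exact .inl (by rw [hn, Int.cast_zero])
    · exact .inr (.inl (by rw [hn, Int.cast_one]))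

theorem height_vertex (c : LiftedDart p) (b : LiftedVertex p) :
    c.height hp b.1 = 0 ∨ c.height hp b.1 = 1 := by
  rcases height_cases hp c b.1 with h | h | ⟨t, ht⟩
  · exact .inl h
  · exact .inr h
  · rcases eq_src_or_eq_tgt ht with rfl | rfl
    · exact .inl (height_path hp c 0)
    · exact .inr (height_path hp c 1)

theorem height_path_of_ne {c c' : LiftedDart p} (h : c' ≠ c) (h' : c' ≠ c.rev) (s t : I) :
    c.height hp (c'.path s) = c.height hp (c'.path t) := by
  refine (AddCircle.isCoveringMap_coe (1 : ℝ)).const_of_comp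
    (g := fun t => c.height hp (c'.path t))
    ((c.height hp).continuous.comp c'.path.continuous) (fun a a' => ?_) s t
  rw [coe_height, coe_height, toCircle_path_of_ne hp h h', toCircle_path_of_ne hp h h']

end Height

section Action

instance : MulAction (deckGroup p) (LiftedVertex p) where
  smul γ b := ⟨γ • b.1, by rw [map_deckGroup_smul (p := p)]; exact b.2⟩
  one_smul _ := rfl
  mul_smul _ _ _ := rfl

instance : MulAction (deckGroup p) (LiftedDart p) where
  smul γ c :=
    { base := c.base
      path := ⟨fun t => γ • c.path t, (continuous_deckGroup_smul γ).comp c.path.continuous⟩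
      lift := fun t => (map_deckGroup_smul γ _).trans (c.lift t) }
  one_smul _ := rfl
  mul_smul _ _ _ := rfl

theorem smul_base (γ : deckGroup p) (c : LiftedDart p) : (γ • c).base = c.base := rfl

theorem smul_path (γ : deckGroup p) (c : LiftedDart p) (t : I) :
    (γ • c).path t = γ • c.path t := rfl

theorem toCircle_smul (γ : deckGroup p) (c : LiftedDart p) (x : X) :
    (γ • c).toCircle (γ • x) = c.toCircle x := by
  have h : γ • x ∈ range (γ • c).path ↔ x ∈ range c.path :=
    exists_congr fun t => by rw [smul_path, smul_left_cancel_iff]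
  unfold toCircle
  rw [map_deckGroup_smul (p := p), smul_base]
  by_cases hx : x ∈ range c.path
  · rw [if_pos (h.2 hx), if_pos hx]
  · rw [if_neg (mt h.1 hx), if_neg hx]

theorem height_smul [SimplyConnectedSpace X] [LocallyPathConnectedSpace X] (hp : IsCoveringMap p)
    (γ : deckGroup p) (c : LiftedDart p) (x : X) :
    (γ • c).height hp (γ • x) = c.height hp x := by
  refine congrFun (height_unique hp c (θ := fun y => (γ • c).height hp (γ • y)) ?_ ?_ ?_) x
  · exact ((γ • c).height hp).continuous.comp (continuous_deckGroup_smul γ)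
  · exact height_path hp (γ • c) 0
  · exact fun y => (coe_height hp (γ • c) _).trans (toCircle_smul γ c y)

end Action

/-- The simply connected covering of a graph as a tree. -/
noncomputable def tree [SimplyConnectedSpace X] [LocallyPathConnectedSpace X]
    (hp : IsCoveringMap p) : CutTree (LiftedVertex p) (LiftedDart p) where
  src := src
  tgt := tgt
  rev := rev
  rev_rev := rev_rev
  src_rev := src_rev
  tgt_rev := tgt_rev
  side c b := c.height hp b.1 = 1
  not_side_src c h := by
    rw [← path_zero, height_path] at h
    exact zero_ne_one h
  side_tgt c := height_path hp c 1
  side_iff c c' h h' := by rw [← path_zero, ← path_one, height_path_of_ne hp h h' 0 1]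
  connected := reflTransGen hp

theorem isFreeAction_tree [SimplyConnectedSpace X] [LocallyPathConnectedSpace X]
    (hp : IsCoveringMap p) : (tree hp).IsFreeAction (deckGroup p) where
  src_smul _ _ := rfl
  tgt_smul _ _ := rfl
  rev_smul _ _ := rfl
  side_smul γ c b := by
    change (γ • c).height hp (γ • b.1) = 1 ↔ c.height hp b.1 = 1
    rw [height_smul]
  eq_one_of_smul_eq γ b h := deckGroup_eq_one_of_smul_eq hp (congrArg Subtype.val h)
  smul_ne_rev γ c h := by
    have := congrArg (fun d => d.base.2) h
    simp [smul_base, tree, rev] at this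

/-- If a self-map `F` of the tree carries the endpoints of the edge `c` to vertices that are
separated by `γ c`, then some point `x` of `c` satisfies `F x = γ x`. -/
theorem exists_apply_eq_smul [SimplyConnectedSpace X] [LocallyPathConnectedSpace X] [T2Space X]
    (hp : IsCoveringMap p) (c : LiftedDart p) (γ : deckGroup p) {F : X → X} (hF : Continuous F)
    {a b : LiftedVertex p} (ha : F c.src.1 = a.1) (hb : F c.tgt.1 = b.1)
    (hsep : ¬ ((tree hp).side (γ • c) a ↔ (tree hp).side (γ • c) b)) :
    ∃ x, F x = γ • x := by
  let y : I → X := fun t => γ⁻¹ • F (c.path t)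
  have hy : Continuous y :=
    (continuous_deckGroup_smul γ⁻¹).comp (hF.comp c.path.continuous)
  let h : I → ℝ := fun t => c.height hp (y t)
  have hh : Continuous h := (c.height hp).continuous.comp hy
  have hside : ∀ d : LiftedVertex p, (γ • c).height hp d.1 = c.height hp (γ⁻¹ • d.1) := fun d => by
    rw [← height_smul hp γ c, smul_inv_smul]
  have hha : h 0 = (γ • c).height hp a.1 := by rw [hside, ← ha]; rfl
  have hhb : h 1 = (γ • c).height hp b.1 := by rw [hside, ← hb]; rfl
  by_contra! hno
  -- At a parameter fixed by `h`, the point `y t` lies off the edge, for otherwise it would agree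
  -- with `c.path t`.
  have hoff : ∀ t : I, h t = t → y t ∉ range c.path := by
    rintro t ht ⟨s, hs⟩
    have h2 : (s : ℝ) = t := by rw [← height_path hp c s, hs]; exact ht
    obtain rfl : s = t := Subtype.ext h2
    refine hno (c.path s) ?_
    calc F (c.path s) = γ • y s := (smul_inv_smul γ _).symm
      _ = γ • c.path s := by rw [hs]
  have hcases : ∀ t, y t ∉ range c.path → h t = 0 ∨ h t = 1 := fun t ht =>
    (height_cases hp c (y t)).imp_right fun h1 => h1.resolve_right ht
  have hval : h 0 = 0 ∧ h 1 = 1 ∨ h 0 = 1 ∧ h 1 = 0 := by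
    change ¬ ((γ • c).height hp a.1 = 1 ↔ (γ • c).height hp b.1 = 1) at hsep
    rw [hha, hhb]
    rcases height_vertex hp (γ • c) a with h1 | h1 <;>
      rcases height_vertex hp (γ • c) b with h2 | h2
    · exact absurd (by rw [h1, h2]) hsep
    · exact .inl ⟨h1, h2⟩
    · exact .inr ⟨h1, h2⟩
    · exact absurd (by rw [h1, h2]) hsep
  rcases hval with ⟨h0, h1⟩ | ⟨h0, h1⟩
  · -- The parameters that `h` decreases and those that it increases form a partition of the
    -- interval into open sets, if parameters fixed by `h` are assigned to them suitably.
    have hopen : IsOpen {t | y t ∉ range c.path} :=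
      (isCompact_range c.path.continuous).isClosed.isOpen_compl.preimage hy
    let P : Set I := {t | h t < t} ∪ {t | y t ∉ range c.path} ∩ {t | h t < 1}
    let Q : Set I := {t | (t : ℝ) < h t} ∪ {t | y t ∉ range c.path} ∩ {t | 0 < h t}
    have hP : IsOpen P := (isOpen_lt hh continuous_subtype_val).union
      (hopen.inter (isOpen_lt hh continuous_const))
    have hQ : IsOpen Q := (isOpen_lt continuous_subtype_val hh).union
      (hopen.inter (isOpen_lt continuous_const hh))
    have hPQ : Pᶜ = Q := by
      ext t
      have ht := t.2
      have h2 := hoff t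
      have h3 := hcases t
      simp only [P, Q, mem_compl_iff, mem_union, mem_inter_iff, mem_ofPred_eq, not_or, not_and,
        not_lt]
      constructor
      · rintro ⟨h4, h5⟩
        rcases h4.lt_or_eq with h6 | h6
        · exact .inl h6
        · exact .inr ⟨h2 h6.symm, one_pos.trans_le (h5 (h2 h6.symm))⟩
      · rintro (h4 | ⟨h4, h5⟩)
        · refine ⟨h4.le, fun h6 => ?_⟩
          rcases h3 h6 with h7 | h7
          · exact absurd (h7 ▸ h4) (not_lt.2 ht.1)
          · exact h7.ge
        · rcases h3 h4 with h7 | h7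
          · exact absurd h7 h5.ne'
          · exact ⟨h7 ▸ ht.2, fun _ => h7.ge⟩
    have hclopen : IsClopen P := ⟨isOpen_compl_iff.1 (hPQ ▸ hQ), hP⟩
    have h0P : (0 : I) ∈ P := .inr ⟨hoff 0 h0, by
      change h 0 < 1
      rw [h0]
      exact one_pos⟩
    have h1Q : (1 : I) ∈ Q := .inr ⟨hoff 1 h1, by
      change 0 < h 1
      rw [h1]
      exact one_pos⟩
    rw [← hPQ, hclopen.eq_univ ⟨0, h0P⟩] at h1Q
    exact h1Q (mem_univ _)
  · obtain ⟨t, ht⟩ : (0 : ℝ) ∈ range fun t : I => h t - t :=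
      mem_range_of_exists_le_of_exists_ge (by fun_prop) ⟨1, by simp [h1]⟩ ⟨0, by simp [h0]⟩
    have ht' : h t = t := sub_eq_zero.1 ht
    rcases hcases t (hoff t ht') with h2 | h2
    · rw [show t = 0 from Subtype.ext (ht'.symm.trans h2)] at h2
      exact zero_ne_one (h2.symm.trans h0)
    · rw [show t = 1 from Subtype.ext (ht'.symm.trans h2)] at h2
      exact zero_ne_one (h1.symm.trans h2)

end LiftedDart

/-! ### Rotation elements -/

variable {p : X → Γ.Realization}

theorem edgePathLifts_of_adj {c : ℤ → LiftedDart p} (hadj : ∀ i, (c i).tgt = (c (i + 1)).src)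
    (n : ℕ) (i : ℤ) :
    Γ.EdgePathLifts p (c i).src.1 ((List.range n).map fun r : ℕ => (c (i + r)).base)
      (c (i + n)).src.1 := by
  induction n generalizing i with
  | zero => simpa using EdgePathLifts.nil (c i).src.1
  | succ n ih =>
    rw [List.range_succ_eq_map, List.map_cons, List.map_map]
    have h := ih (i + 1)
    let γ : Path (c i).src.1 (c (i + 1)).src.1 :=
      ⟨(c i).path, rfl, congrArg Subtype.val (hadj i)⟩
    simp only [Nat.cast_zero, add_zero]
    refine .cons γ (c i).lift ?_
    convert h using 2
    · refine funext fun r => ?_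
      simp only [Function.comp_apply, Nat.cast_succ]
      congr 2
      ring
    · congr 2
      push_cast
      ring

/-- One period of the axis of `g` is a cyclic reduction of `g`. -/
theorem isCyclicReduction_of_isAxis [SimplyConnectedSpace X] [LocallyPathConnectedSpace X]
    (hp : IsCoveringMap p) {g : deckGroup p} {c : ℤ → LiftedDart p} {n : ℕ}
    (hc : (LiftedDart.tree hp).IsAxis g c n) :
    Γ.IsCyclicReduction p g ((List.range n).map fun r : ℕ => (c r).base) := by
  have hred : ∀ i, (c (i + 1)).base ≠ ((c i).base.1, !(c i).base.2) := by
    intro i h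
    refine hc.reduced i (LiftedDart.eq_of_path_eq hp h (t := 0) ?_)
    have h1 : (c i).tgt = (c (i + 1)).src := hc.adj i
    rw [LiftedDart.path_zero, ← h1]
    exact congrArg Subtype.val (c i).src_rev.symm
  constructor
  · obtain ⟨m, rfl⟩ : ∃ m, n = m + 1 := Nat.exists_eq_succ_of_ne_zero (by
      have := hc.pos
      omega)
    rw [← Cycle.map_coe, Cycle.chain_map, ← Nat.succ_eq_add_one, Cycle.chain_range_succ]
    refine ⟨?_, fun r _ => by exact_mod_cast hred r⟩
    have h1 := hred m
    have h2 := hc.smul 0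
    rw [zero_add] at h2
    rwa [show (m : ℤ) + 1 = ((m + 1 : ℕ) : ℤ) by push_cast; rfl, ← h2] at h1
  · refine ⟨(c 0).src.1, ?_⟩
    have h1 := edgePathLifts_of_adj (c := c) hc.adj n 0
    have h2 := hc.smul 0
    simp only [zero_add] at h1 h2
    rw [← h2] at h1
    exact h1

/-- If all vertices lie on one orbit, then `F ^ v` moves every vertex of the universal covering by
a conjugate of the element `w` by which it moves one of them. -/
theorem exists_conj_smul [SimplyConnectedSpace X] [LocallyPathConnectedSpace X]
    (hp : IsCoveringMap p) {f : Γ.Realization → Γ.Realization} {F : X → X}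
    (hF : IsEquivariantLift p f F) (horbit : Γ.VerticesFormOnePeriodicOrbit f) {v : ℕ}
    {w : deckGroup p} {a₀ : LiftedVertex p} (hw : F^[v] a₀.1 = w • a₀.1) (a : LiftedVertex p) :
    ∃ g : deckGroup p, F^[v] a.1 = (g * w * g⁻¹) • a.1 := by
  obtain ⟨x, ⟨n, hn, hx⟩, hrange⟩ := horbit
  have hmem : ∀ b : LiftedVertex p, ∃ i : ℕ, f^[i] x = p b.1 := fun b => by
    obtain ⟨v', hv'⟩ := b.2
    have : Γ.vertex v' ∈ range fun k : ℕ => f^[k] x := hrange ▸ mem_range_self v'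
    exact this.imp fun i hi => hi.trans hv'.symm
  obtain ⟨i, hi⟩ := hmem a₀
  obtain ⟨j, hj⟩ := hmem a
  obtain ⟨l, hl⟩ : ∃ l : ℕ, l + i = j + i * n :=
    ⟨j + i * n - i, Nat.sub_add_cancel (le_add_left (Nat.le_mul_of_pos_right i hn))⟩
  have h1 : p (F^[l] a₀.1) = p a.1 := by
    rw [(hF.iterate l).lift, ← hi, ← Function.iterate_add_apply, hl, Function.iterate_add_apply,
      (hx.const_mul i).eq, hj]
  obtain ⟨g, hg⟩ := exists_deckGroup_smul_eq hp h1
  have h2 : F^[v] (F^[l] a₀.1) = w • F^[l] a₀.1 := by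
    rw [← Function.iterate_add_apply, add_comm, Function.iterate_add_apply, hw,
      (hF.iterate l).map_smul]
  refine ⟨g, ?_⟩
  have h3 := (hF.iterate v).apply_eq_conj_smul h2 g
  rwa [hg] at h3

/-- If every edge of the graph belongs to `w`, then the axis of `w` meets the orbits of all
lifted edges. -/
theorem exists_eq_smul_of_belongs [SimplyConnectedSpace X] [LocallyPathConnectedSpace X]
    (hp : IsCoveringMap p) {g : deckGroup p} {c : ℤ → LiftedDart p} {n : ℕ}
    (hc : (LiftedDart.tree hp).IsAxis g c n) (hbelongs : ∀ e, Γ.Belongs p e g)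
    (d : LiftedDart p) :
    ∃ i, ∃ u : deckGroup p, c i = u • d ∨ c i = u • d.rev := by
  obtain ⟨b, hb⟩ := hbelongs d.base.1 _ (isCyclicReduction_of_isAxis hp hc)
  obtain ⟨r, -, hr⟩ := List.mem_map.1 hb
  have key : ∀ d' : LiftedDart p, (c r).base = d'.base → ∃ u : deckGroup p, c r = u • d' := by
    intro d' hd'
    obtain ⟨u, hu⟩ := exists_deckGroup_smul_eq hp (x := d'.path 0) (y := (c r).path 0)
      (by rw [d'.lift, (c r).lift, hd'])
    exact ⟨u, LiftedDart.eq_of_path_eq hp hd' hu.symm⟩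
  by_cases hb' : b = d.base.2
  · obtain ⟨u, hu⟩ := key d (by rw [hr, hb'])
    exact ⟨r, u, .inl hu⟩
  · obtain ⟨u, hu⟩ := key d.rev (by
      rw [hr]
      exact Prod.ext rfl (Bool.eq_not_of_ne hb'))
    exact ⟨r, u, .inr hu⟩

theorem ne_one_of_belongs [SimplyConnectedSpace X] (hp : IsCoveringMap p)
    (hπ : ¬ IsCyclic (deckGroup p)) {w : deckGroup p} (a : LiftedVertex p)
    (hbelongs : ∀ e, Γ.Belongs p e w) : w ≠ 1 := by
  rintro rfl
  -- The empty loop is a cyclic reduction of `1`, so the graph has no edges.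
  have hE : IsEmpty (LiftedDart p) := ⟨fun d => by
    obtain ⟨b, hb⟩ := hbelongs d.base.1 [] ⟨Cycle.Chain.nil _, a.1, .nil a.1⟩
    simp at hb⟩
  have htriv : ∀ γ : deckGroup p, γ = 1 := by
    intro γ
    have h := LiftedDart.reflTransGen hp a (γ • a)
    rcases h.cases_head with h | ⟨_, ⟨d, -⟩, -⟩
    · exact deckGroup_eq_one_of_smul_eq hp (congrArg Subtype.val h).symm
    · exact hE.elim d
  have : Subsingleton (deckGroup p) := ⟨fun γ δ => by rw [htriv γ, htriv δ]⟩
  exact hπ inferInstance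

end Multigraph

theorem mainTheorem7 {V E : Type*} [Finite V] [Finite E] (Γ : Multigraph V E)
    [ConnectedSpace Γ.Realization]
    -- the fundamental group has at least two generators
    (x₀ : V) (hπ : ¬ IsCyclic (FundamentalGroup Γ.Realization (Γ.vertex x₀)))
    -- the universal covering space
    {X : Type*} [TopologicalSpace X] [SimplyConnectedSpace X]
    (p : X → Γ.Realization) (hp : IsCoveringMap p)
    (f : C(Γ.Realization, Γ.Realization))
    (hf : ContinuousMap.Homotopic f (ContinuousMap.id Γ.Realization))
    (horbit : Γ.VerticesFormOnePeriodicOrbit f)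
    (F : C(X, X)) (hF : IsEquivariantLift p f F)
    (v₀ : V) (w : deckGroup p) (v : ℕ)
    (hw : HasRotationElement p F (Γ.vertex v₀) w v)
    (hbelongs : ∀ e : E, Γ.Belongs p e w) :
    ∃ (z : ℕ → Γ.Realization) (u : ℕ → deckGroup p) (n : ℕ → ℕ),
      (∀ i, f^[n i] (z i) = z i ∧ HasRotationElement p F (z i) (u i) (n i)) ∧
      (∀ i j, i ≠ j → ∀ k : ℕ, f^[k] (z i) ≠ z j) ∧
      (∀ i j, i ≠ j → ¬ SameRotation (u i) (n i) (u j) (n j)) := by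
  have : LocallyPathConnectedSpace X := hp.isLocalHomeomorph.locallyPathConnectedSpace
  have : T2Space X := hp.t2Space
  have : PathConnectedSpace Γ.Realization := .of_locallyPathConnectedSpace
  have hdeck : ¬ IsCyclic (deckGroup p) := fun _ =>
    hπ (isCyclic_fundamentalGroup hp hp.surjective _)
  obtain ⟨hv, x, hx, hwx⟩ := hw
  let a₀ : Multigraph.LiftedVertex p := ⟨x, v₀, hx⟩
  have hT := Multigraph.LiftedDart.isFreeAction_tree hp
  have hnonempty : Nonempty (Multigraph.LiftedVertex p) := ⟨a₀⟩
  choose g hg using Multigraph.exists_conj_smul hp hF horbit (a₀ := a₀) hwx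
  let W : Multigraph.LiftedVertex p → deckGroup p := fun a => g a * w * (g a)⁻¹
  have huniq : ∀ (a : Multigraph.LiftedVertex p) (u : deckGroup p), F^[v] a.1 = u • a.1 →
      W a = u := by
    intro a u h
    have h1 : (u⁻¹ * W a) • a.1 = a.1 := by rw [mul_smul, ← hg, h, inv_smul_smul]
    exact (inv_mul_eq_one.1 (deckGroup_eq_one_of_smul_eq hp h1)).symm
  have hW : ∀ a (u : deckGroup p), W (u • a) = u * W a * u⁻¹ := fun a u =>
    huniq _ _ ((hF.iterate v).apply_eq_conj_smul (hg a) u)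
  have hWa₀ : W a₀ = w := huniq a₀ w hwx
  obtain ⟨c, m, hc⟩ := CutTree.exists_isAxis hT (Multigraph.ne_one_of_belongs hp hdeck a₀ hbelongs)
  -- The vertices of a suitable edge `d` are driven apart by `F`, and a fixed proper translate
  -- `u • d` separates them from some time on.
  obtain ⟨d, u, hu, hev⟩ := CutTree.exists_separating_smul hT hdeck W hW a₀
    (fun a => hWa₀.symm ▸ isConj_iff.2 ⟨g a, rfl⟩) (hWa₀.symm ▸ hc)
    (Multigraph.exists_eq_smul_of_belongs hp hc hbelongs)
  obtain ⟨k₀, hk₀⟩ := Filter.eventually_atTop.1 hev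
  have hpow : ∀ (k : ℕ) (a : Multigraph.LiftedVertex p),
      F^[v * k] a.1 = (W a ^ k • a).1 := fun k a => by
    rw [Function.iterate_mul]
    exact (hF.iterate v).iterate_eq_pow_smul (hg a) k
  have hex : ∀ i : ℕ, ∃ y, F^[v * (k₀ + i + 1)] y = u • y := fun i =>
    Multigraph.LiftedDart.exists_apply_eq_smul hp d u (F.continuous.iterate _) (hpow _ _) (hpow _ _)
      (hk₀ (k₀ + i + 1) (by omega))
  choose y hy using hex
  have hrot : ∀ i j, i ≠ j → ¬ SameRotation u (v * (k₀ + i + 1)) u (v * (k₀ + j + 1)) := by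
    intro i j hij h
    obtain ⟨c', m', hc'⟩ := CutTree.exists_isAxis hT hu
    have h1 := hc'.eq_of_isConj_pow hT (by positivity) (by positivity) h
    have h2 := Nat.eq_of_mul_eq_mul_left hv h1
    omega
  refine ⟨fun i => p (y i), fun _ => u, fun i => v * (k₀ + i + 1), fun i => ⟨?_, ?_⟩, ?_, hrot⟩
  · rw [← (hF.iterate _).lift, hy]
    exact map_deckGroup_smul u (y i)
  · exact ⟨by positivity, y i, rfl, hy i⟩
  · exact fun i j hij k hk => hrot i j hij (hF.sameRotation hp (hy i) (hy j) hk)
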